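/- **Corollary (Morse equality via persistence pairs).** Let $K$ be a finite simplicial complex and let $f\colon K\to\mathbb R$ be a discrete Morse function, i.e. for every $p$-simplex $\sigma$ of $K$ at most one $(p+1)$-simplex $\tau\succ\sigma$ has $f(\tau)\le f(\sigma)$ and at most one $(p-1)$-simplex $\nu\prec\sigma$ has $f(\sigma)\le f(\nu)$; $\sigma$ is *critical* if there is no such $\tau$ and no such $\nu$. Assume that $f$ is excellent, i.e. different critical simplices have different values. Homology is simplicial (unreduced), with coefficients in a finite field $\mathbb F$. For $c\in\mathbb R$ let $K(c)$ (resp. $K(<c)$) be the subcomplex of all simplices $\sigma$ of $K$ with $f(\sigma)\le c$ (resp. $f(\sigma)<c$) together with all their faces. If $c_1<\dots<c_n$ are the values of $f$, then $K(<c_i)=K(c_{i-1})$, with $K(c_0)=\varnothing$. A class $h\in H_p(K(b))$ *is born at* $b$ if it is not in the image of $H_p(K(<b))\to H_p(K(b))$. It *dies at* $d>b$ (elder rule) if its image in $H_p(K(<d))$ is not in the image of $H_p(K(<b))\to H_p(K(<d))$, but its image in $H_p(K(d))$ is in the image of $H_p(K(<b))\to H_p(K(d))$. All maps are induced by inclusion.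 A *finite persistence pair* of $f$ is a pair $(\sigma,\tau)$ of critical simplices with $f(\sigma)<f(\tau)$ such that, for some $p$, some class $h\in H_p(K(f(\sigma)))$ is born at $f(\sigma)$ and dies at $f(\tau)$; $\sigma$ is its birth simplex and $\tau$ its death simplex. Let $C_q$ be the number of critical $q$-simplices of $f$, let $\beta_q=\dim_{\mathbb F}H_q(K;\mathbb F)$, and let $\hat P_q$ be the set of finite persistence pairs whose birth simplex has dimension $q$ (so $\hat P_{-1}=\varnothing$). Then for every integer $q\ge 0$, $$C_q=\beta_q+\#\hat P_{q-1}+\#\hat P_q .$$ -/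

import Mathlib

namespace DiscreteMorse

section Subquotient

variable {R M : Type*} [Ring R] [AddCommGroup M] [Module R M]

/-- The quotient `Z / B` of submodules `B ≤ Z` of a module. -/
abbrev Subquotient (Z B : Submodule R M) : Type _ := Z ⧸ B.submoduleOf Z

/-- The map `Z / B → Z' / B'` induced by inclusions `Z ≤ Z'` and `B ≤ B'`. -/
def subquotientMap {Z B Z' B' : Submodule R M} (hZ : Z ≤ Z') (hB : B ≤ B') :
    Subquotient Z B →ₗ[R] Subquotient Z' B' :=
  Submodule.mapQ _ _ (Submodule.inclusion hZ) (fun _ hx => hB hx)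

end Subquotient

section Homology

variable (F : Type*) [Field F] {ι : Type*} [LinearOrder ι]

/-- The simplicial boundary of a simplex, given by its finite vertex set `σ`, with the orientation
coming from the linear order on the vertices: if `σ = {v₀ < ⋯ < v_q}` with `1 ≤ q`, then it is
`∑ i, (-1) ^ i • (σ \ {v_i})`; the boundary of a vertex is `0` (unreduced homology). -/
noncomputable def simplexBoundary (σ : Finset ι) : Finset ι →₀ F :=
  if σ.card ≤ 1 then 0
  else ∑ v ∈ σ, Finsupp.single (σ.erase v) ((-1 : F) ^ (σ.filter (· < v)).card)

/-- The boundary operator, the linear extension of `simplexBoundary`. -/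
noncomputable def boundary : (Finset ι →₀ F) →ₗ[F] (Finset ι →₀ F) :=
  Finsupp.linearCombination F (simplexBoundary F)

/-- The chain group `C_q(K; F)`: formal linear combinations of the `q`-simplices of `K`. -/
noncomputable def chains (K : PreAbstractSimplicialComplex ι) (q : ℕ) :
    Submodule F (Finset ι →₀ F) :=
  Finsupp.supported F F {σ | σ ∈ K ∧ σ.card = q + 1}

/-- The cycles `Z_q(K) = ker ∂_q`. -/
noncomputable def cycles (K : PreAbstractSimplicialComplex ι) (q : ℕ) :
    Submodule F (Finset ι →₀ F) :=
  chains F K q ⊓ LinearMap.ker (boundary F)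

/-- The boundaries `B_q(K) = im ∂_{q+1}`. -/
noncomputable def boundaries (K : PreAbstractSimplicialComplex ι) (q : ℕ) :
    Submodule F (Finset ι →₀ F) :=
  (chains F K (q + 1)).map (boundary F)

/-- `∂ ∘ ∂ = 0`. -/
lemma boundary_simplexBoundary (σ : Finset ι) :
    boundary F (simplexBoundary F σ) = 0 := by
  by_cases h : σ.card ≤ 1
  · simp [simplexBoundary, h]
  by_cases h2 : σ.card = 2
  · simp only [simplexBoundary, h, if_false, map_sum]
    refine Finset.sum_eq_zero fun v hv => ?_
    simp [boundary, simplexBoundary, Finset.card_erase_of_mem hv, h2]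
  have h3 : ∀ v ∈ σ, ¬ (σ.erase v).card ≤ 1 := fun v hv => by
    rw [Finset.card_erase_of_mem hv]; omega
  have : boundary F (simplexBoundary F σ) = ∑ v ∈ σ, ∑ w ∈ σ.erase v,
      Finsupp.single ((σ.erase v).erase w) ((-1 : F) ^ (σ.filter (· < v)).card *
        (-1 : F) ^ ((σ.erase v).filter (· < w)).card) := by
    simp only [simplexBoundary, h, if_false, map_sum]
    refine Finset.sum_congr rfl fun v hv => ?_
    simp [boundary, simplexBoundary, h3 v hv, Finset.smul_sum]
  rw [this, Finset.sum_sigma']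
  have key : ∀ v ∈ σ, ∀ w ∈ σ, v < w →
      (-1 : F) ^ (σ.filter (· < v)).card * (-1 : F) ^ ((σ.erase v).filter (· < w)).card +
      (-1 : F) ^ (σ.filter (· < w)).card * (-1 : F) ^ ((σ.erase w).filter (· < v)).card = 0 := by
    intro v hv w hw hvw
    have e1 : (σ.erase w).filter (· < v) = σ.filter (· < v) := by
      ext x; simp only [Finset.mem_filter, Finset.mem_erase]; grind
    have e2 : (σ.filter (· < w)).card = ((σ.erase v).filter (· < w)).card + 1 := by
      rw [Finset.filter_erase, Finset.card_erase_add_one]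
      simp [hv, hvw]
    rw [e1, e2]; ring
  refine Finset.sum_involution (fun x _ => ⟨x.2, x.1⟩) ?_ ?_ ?_ ?_
  · rintro ⟨v, w⟩ hx
    simp only [Finset.mem_sigma, Finset.mem_erase] at hx
    obtain ⟨hv, hne, hw⟩ := hx
    dsimp only
    rw [Finset.erase_right_comm, ← Finsupp.single_add]
    rcases lt_or_gt_of_ne hne with hl | hl
    · rw [add_comm, key w hw v hv hl, Finsupp.single_zero]
    · rw [key v hv w hw hl, Finsupp.single_zero]
  · rintro ⟨v, w⟩ hx _ he
    simp only [Finset.mem_sigma, Finset.mem_erase] at hx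
    simp only [Sigma.mk.injEq] at he
    exact hx.2.1 he.1
  · rintro ⟨v, w⟩ hx
    simp only [Finset.mem_sigma, Finset.mem_erase] at hx ⊢
    exact ⟨hx.2.2, Ne.symm hx.2.1, hx.1⟩
  · rintro ⟨v, w⟩ _; rfl

lemma boundaries_le_cycles
    (K : PreAbstractSimplicialComplex ι) (q : ℕ) :
    boundaries F K q ≤ cycles F K q := by
  rintro _ ⟨x, hx, rfl⟩
  simp only [chains, SetLike.mem_coe, Finsupp.mem_supported] at hx
  have hx' : x = x.sum fun σ a => Finsupp.single σ a := (Finsupp.sum_single x).symm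
  rw [hx', Finsupp.sum, map_sum]
  refine Submodule.sum_mem _ fun σ hσ => ?_
  obtain ⟨hσK, hc⟩ := hx hσ
  have e : boundary F (Finsupp.single σ (x σ)) = x σ • simplexBoundary F σ := by simp [boundary]
  rw [e]
  refine Submodule.smul_mem _ _ ⟨?_, boundary_simplexBoundary F σ⟩
  rw [simplexBoundary, if_neg (by omega)]
  refine Submodule.sum_mem _ fun v hv => Finsupp.single_mem_supported F _ ⟨?_, ?_⟩
  · exact (K.isRelLowerSet_faces hσK).2 (Finset.erase_subset _ _)
      (Finset.card_pos.mp (by rw [Finset.card_erase_of_mem hv]; omega))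
  · rw [Finset.card_erase_of_mem hv]; omega

/-- The simplicial homology `H_q(K; F) = Z_q(K) / B_q(K)`. -/
abbrev Homology (K : PreAbstractSimplicialComplex ι) (q : ℕ) : Type _ :=
  Subquotient (cycles F K q) (boundaries F K q)

/-- The `q`-th Betti number. -/
noncomputable def betti (K : PreAbstractSimplicialComplex ι) (q : ℕ) : ℕ :=
  Module.finrank F (Homology F K q)

lemma chains_mono {F ι : Type*} [Field F] {K L : PreAbstractSimplicialComplex ι} (h : K ≤ L)
    (q : ℕ) : chains F K q ≤ chains F L q :=
  Finsupp.supported_mono fun _ hσ => ⟨h hσ.1, hσ.2⟩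

variable {K L : PreAbstractSimplicialComplex ι}

lemma cycles_mono (h : K ≤ L) (q : ℕ) : cycles F K q ≤ cycles F L q :=
  inf_le_inf_right _ (chains_mono h q)

lemma boundaries_mono (h : K ≤ L) (q : ℕ) : boundaries F K q ≤ boundaries F L q :=
  Submodule.map_mono (chains_mono h (q + 1))

/-- The map `H_q(K) → H_q(L)` induced by the inclusion of a subcomplex `K` of `L`. -/
noncomputable def homologyMap (h : K ≤ L) (q : ℕ) : Homology F K q →ₗ[F] Homology F L q :=
  subquotientMap (cycles_mono F h q) (boundaries_mono F h q)

end Homology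

section Morse

variable {ι : Type*}

/-- The dimension of a simplex with vertex set `σ`. -/
def dim (σ : Finset ι) : ℤ := (σ.card : ℤ) - 1

/-- `{τ^(p+1) ≻ σ | f τ ≤ f σ}` for `σ = σ^(p)`. -/
def upperExceptions (K : PreAbstractSimplicialComplex ι) (f : Finset ι → ℝ) (σ : Finset ι) :
    Set (Finset ι) :=
  {τ | τ ∈ K ∧ σ ⊆ τ ∧ dim τ = dim σ + 1 ∧ f τ ≤ f σ}

/-- `{ν^(p-1) ≺ σ | f σ ≤ f ν}` for `σ = σ^(p)`. -/
def lowerExceptions (K : PreAbstractSimplicialComplex ι) (f : Finset ι → ℝ) (σ : Finset ι) :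
    Set (Finset ι) :=
  {ν | ν ∈ K ∧ ν ⊆ σ ∧ dim ν = dim σ - 1 ∧ f σ ≤ f ν}

/-- `f` is a discrete Morse function on `K`. Here, as everywhere below, only the values of `f` on
the simplices of `K` matter. -/
def IsDiscreteMorse (K : PreAbstractSimplicialComplex ι) (f : Finset ι → ℝ) : Prop :=
  ∀ σ ∈ K, (upperExceptions K f σ).encard ≤ 1 ∧ (lowerExceptions K f σ).encard ≤ 1

/-- `σ` is a critical simplex of `f`. -/
def IsCritical (K : PreAbstractSimplicialComplex ι) (f : Finset ι → ℝ) (σ : Finset ι) : Prop :=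
  σ ∈ K ∧ upperExceptions K f σ = ∅ ∧ lowerExceptions K f σ = ∅

/-- `f` is excellent: different critical simplices have different values. -/
def IsExcellent (K : PreAbstractSimplicialComplex ι) (f : Finset ι → ℝ) : Prop :=
  Set.InjOn f {σ | IsCritical K f σ}

/-- The critical `q`-simplices of `f`. -/
def criticalSimplices (K : PreAbstractSimplicialComplex ι) (f : Finset ι → ℝ) (q : ℤ) :
    Set (Finset ι) :=
  {σ | IsCritical K f σ ∧ dim σ = q}

/-- The sub-level complex `K(c)`: the simplices of value at most `c`, and all their faces. -/
def sublevel (K : PreAbstractSimplicialComplex ι) (f : Finset ι → ℝ) (c : ℝ) :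
    PreAbstractSimplicialComplex ι where
  faces := {τ | τ.Nonempty ∧ ∃ σ ∈ K, f σ ≤ c ∧ τ ⊆ σ}
  isRelLowerSet_faces := fun _ ⟨hne, σ, hσ, hc, hs⟩ =>
    ⟨hne, fun _ hts ht => ⟨ht, σ, hσ, hc, hts.trans hs⟩⟩

/-- The simplices of value less than `c`, and all their faces. If the values of `f` on `K` are
`c₁ < ⋯ < c_n`, then for `c = c_i` this is the preceding step `K(c_{i-1})` of the filtration
`K(c₁) ⊆ ⋯ ⊆ K(c_n) = K` (the empty complex for `i = 1`). -/
def sublevelLT (K : PreAbstractSimplicialComplex ι) (f : Finset ι → ℝ) (c : ℝ) :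
    PreAbstractSimplicialComplex ι where
  faces := {τ | τ.Nonempty ∧ ∃ σ ∈ K, f σ < c ∧ τ ⊆ σ}
  isRelLowerSet_faces := fun _ ⟨hne, σ, hσ, hc, hs⟩ =>
    ⟨hne, fun _ hts ht => ⟨ht, σ, hσ, hc, hts.trans hs⟩⟩

variable {K : PreAbstractSimplicialComplex ι} {f : Finset ι → ℝ} {c d : ℝ}

lemma sublevel_mono (h : c ≤ d) : sublevel K f c ≤ sublevel K f d :=
  fun _ ⟨hne, σ, hσ, hc, hs⟩ => ⟨hne, σ, hσ, hc.trans h, hs⟩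

lemma sublevelLT_le : sublevelLT K f c ≤ sublevel K f c :=
  fun _ ⟨hne, σ, hσ, hc, hs⟩ => ⟨hne, σ, hσ, hc.le, hs⟩

lemma sublevel_le_sublevelLT (h : c < d) : sublevel K f c ≤ sublevelLT K f d :=
  fun _ ⟨hne, σ, hσ, hc, hs⟩ => ⟨hne, σ, hσ, hc.trans_lt h, hs⟩

end Morse

section Persistence

variable (F : Type*) [Field F] {ι : Type*} [LinearOrder ι]

/-- The class `x ∈ H_p(K(b))` is born at the value `b`: it does not come from the preceding step
of the filtration. -/
def IsBornAt (K : PreAbstractSimplicialComplex ι) (f : Finset ι → ℝ) (b : ℝ) {p : ℕ}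
    (x : Homology F (sublevel K f b) p) : Prop :=
  x ∉ LinearMap.range (homologyMap F (sublevelLT_le (K := K) (f := f) (c := b)) p)

/-- The class `x ∈ H_p(K(b))` dies at the value `d > b`, according to the elder rule: `d` is the
step of the filtration at which the image of `x` becomes trivial or merges with an older class,
that is, with a class coming from the step preceding `K(b)`. -/
def DiesAt (K : PreAbstractSimplicialComplex ι) (f : Finset ι → ℝ) {b d : ℝ} (hbd : b < d) {p : ℕ}
    (x : Homology F (sublevel K f b) p) : Prop :=
  homologyMap F (sublevel_le_sublevelLT hbd) p x ∉ LinearMap.range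
      (homologyMap F ((sublevelLT_le (K := K) (f := f)).trans (sublevel_le_sublevelLT hbd)) p) ∧
    homologyMap F (sublevel_mono hbd.le) p x ∈ LinearMap.range
      (homologyMap F ((sublevelLT_le (K := K) (f := f)).trans (sublevel_mono hbd.le)) p)

/-- `(σ, τ)` is a (finite) persistence pair of `f`: the critical simplices `σ`, `τ` are the birth
simplex and the death simplex of some homology class (of any dimension). -/
def IsPersistencePair (K : PreAbstractSimplicialComplex ι) (f : Finset ι → ℝ) (σ τ : Finset ι) :
    Prop :=
  IsCritical K f σ ∧ IsCritical K f τ ∧ ∃ hlt : f σ < f τ, ∃ p : ℕ,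
    ∃ x : Homology F (sublevel K f (f σ)) p, IsBornAt F K f (f σ) x ∧ DiesAt F K f hlt x

/-- The set `P̂_q` of finite persistence pairs whose birth simplex has dimension `q`. -/
def finitePairs (K : PreAbstractSimplicialComplex ι) (f : Finset ι → ℝ) (q : ℤ) :
    Set (Finset ι × Finset ι) :=
  {P | IsPersistencePair F K f P.1 P.2 ∧ dim P.1 = q}

end Persistence

end DiscreteMorse

namespace DiscreteMorse

/-! ### Chains as finitely supported functions. -/

section Chains

variable {F : Type*} [Field F] {ι : Type*} {M : PreAbstractSimplicialComplex ι} {q : ℕ}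

/-! Fix a value `c` and consider the new simplices, those of `K(c)` outside `K(<c)`. By the Morse
condition each has at most one new facet and at most one new cofacet (`IsDiscreteMorse.isMatched`).
Those with neither are the critical simplices of value `c` (`IsDiscreteMorse.mem_unmatched`), and
excellence allows at most one.

Matched pairs can be cancelled, so a relative cycle that avoids the critical simplex can be pushed
into `K(<c)` (`IsMatched.exists_sub_boundary_mem`). Hence homology can change only at critical
values, and a critical `q`-simplex either raises `dim H_q` by one or kills a line in `H_{q-1}`
(`IsMatched.finrank_zero`, `IsMatched.finrank_succ`).

The link with persistence is `ncard_pairsAt`: the pairs with birth dimension `q` and death value `c`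
number `dim ker (H_q(K(<c)) → H_q(K(c)))`, which is 0 or 1. This gives a balance at each value
(`finrank_homology_sublevel`), and the sum over all values telescopes to the homology of `K`. -/

lemma mem_chains {z : Finset ι →₀ F} :
    z ∈ chains F M q ↔ ∀ σ, z σ ≠ 0 → σ ∈ M ∧ σ.card = q + 1 := by
  simp only [chains, Finsupp.mem_supported, Set.subset_def, Finset.mem_coe, Finsupp.mem_support_iff,
    Set.mem_ofPred_eq]

lemma single_mem_chains {σ : Finset ι} (hσ : σ ∈ M) (hc : σ.card = q + 1) :
    Finsupp.single σ (1 : F) ∈ chains F M q :=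
  Finsupp.single_mem_supported F _ ⟨hσ, hc⟩

lemma nonempty_of_mem {σ : Finset ι} (h : σ ∈ M) : σ.Nonempty := (M.isRelLowerSet_faces h).1

lemma mem_of_subset {σ ν : Finset ι} (h : σ ∈ M) (hs : ν ⊆ σ) (hν : ν.Nonempty) : ν ∈ M :=
  (M.isRelLowerSet_faces h).2 hs hν

lemma finite_chains (hM : M.faces.Finite) : Module.Finite F (chains F M q) := by
  have hfin : Finite {σ | σ ∈ M ∧ σ.card = q + 1} := (hM.subset fun _ h => h.1).to_subtype
  exact Module.Finite.equiv (Finsupp.supportedEquivFinsupp (M := F) (R := F) _).symm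

end Chains

/-! ### Cancelling matched simplices in chains. -/

section ChainLevel

variable {F : Type*} [Field F] {ι : Type*} [LinearOrder ι]

lemma simplexBoundary_apply_eq_zero {σ ν : Finset ι} (h : ¬ (ν ⊆ σ ∧ σ.card = ν.card + 1)) :
    simplexBoundary F σ ν = 0 := by
  rw [simplexBoundary]
  split_ifs with hc
  · rfl
  rw [Finsupp.finsetSum_apply]
  refine Finset.sum_eq_zero fun v hv => Finsupp.single_eq_of_ne ?_
  rintro rfl
  exact h ⟨Finset.erase_subset _ _, (Finset.card_erase_add_one hv).symm⟩

lemma simplexBoundary_apply_ne_zero {σ ν : Finset ι} (hν : ν.Nonempty) (hs : ν ⊆ σ)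
    (hc : σ.card = ν.card + 1) : simplexBoundary F σ ν ≠ 0 := by
  have hpos := hν.card_pos
  obtain ⟨v, hv, rfl⟩ : ∃ v ∈ σ, σ.erase v = ν := by
    obtain ⟨v, hv⟩ : ∃ v, v ∈ σ \ ν := by
      rw [← Finset.Nonempty, ← Finset.card_pos, Finset.card_sdiff_of_subset hs]; omega
    rw [Finset.mem_sdiff] at hv
    refine ⟨v, hv.1, (Finset.eq_of_subset_of_card_le ?_ ?_).symm⟩
    · exact fun x hx => Finset.mem_erase.mpr ⟨fun h => hv.2 (h ▸ hx), hs hx⟩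
    · rw [Finset.card_erase_of_mem hv.1]; omega
  rw [simplexBoundary, if_neg (by omega), Finsupp.finsetSum_apply, Finset.sum_eq_single_of_mem v hv]
  · simp
  · intro w hw hwv
    refine Finsupp.single_eq_of_ne fun h => hwv ?_
    exact (Finset.erase_injOn σ hv hw h).symm

lemma boundary_apply (z : Finset ι →₀ F) (ν : Finset ι) :
    boundary F z ν = z.sum fun τ a => a * simplexBoundary F τ ν := by
  simp [boundary, Finsupp.linearCombination_apply, Finsupp.sum]

lemma boundary_single (σ : Finset ι) : boundary F (Finsupp.single σ 1) = simplexBoundary F σ := by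
  simp [boundary]

lemma boundary_boundary (z : Finset ι →₀ F) : boundary F (boundary F z) = 0 := by
  induction z using Finsupp.induction_linear with
  | zero => simp
  | add x y hx hy => simp [hx, hy]
  | single σ a =>
    rw [show Finsupp.single σ a = a • Finsupp.single σ (1 : F) by simp, map_smul, map_smul,
      boundary_single, boundary_simplexBoundary, smul_zero]

variable {L M : PreAbstractSimplicialComplex ι}

lemma boundary_mem_boundaries {z : Finset ι →₀ F} {q : ℕ} (hz : z ∈ chains F M (q + 1)) :
    boundary F z ∈ boundaries F M q := ⟨z, hz, rfl⟩

lemma boundary_mem_cycles {z : Finset ι →₀ F} {q : ℕ} (hz : z ∈ chains F M (q + 1)) :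
    boundary F z ∈ cycles F M q := boundaries_le_cycles F M q (boundary_mem_boundaries hz)

/-- `σ` is a facet of `τ`, and both are simplices of `M` that do not belong to `L`. -/
def NewFacet (L M : PreAbstractSimplicialComplex ι) (σ τ : Finset ι) : Prop :=
  σ ∈ M ∧ σ ∉ L ∧ τ ∈ M ∧ σ ⊆ τ ∧ τ.card = σ.card + 1

/-- The simplices of `M` outside `L` that are not matched by `NewFacet`. -/
def unmatched (L M : PreAbstractSimplicialComplex ι) : Set (Finset ι) :=
  {α | α ∈ M ∧ α ∉ L ∧ (∀ τ, ¬ NewFacet L M α τ) ∧ ∀ ν, ¬ NewFacet L M ν α}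

/-- `NewFacet` is a matching of simplices of `M` outside `L`. -/
structure IsMatched (L M : PreAbstractSimplicialComplex ι) : Prop where
  le : L ≤ M
  up : ∀ ⦃σ τ τ'⦄, NewFacet L M σ τ → NewFacet L M σ τ' → τ = τ'
  down : ∀ ⦃σ σ' τ⦄, NewFacet L M σ τ → NewFacet L M σ' τ → σ = σ'

/-- `σ` has no cofacet in `M`. This makes the coefficient at `σ` well defined on homology classes.
-/
lemma boundary_apply_of_unmatched {σ : Finset ι} (hσ : σ ∈ unmatched L M) {q : ℕ}
    {w : Finset ι →₀ F} (hw : w ∈ chains F M q) : boundary F w σ = 0 := by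
  rw [boundary_apply]
  refine Finset.sum_eq_zero fun τ hτ => ?_
  dsimp only
  rw [simplexBoundary_apply_eq_zero, mul_zero]
  exact fun h => hσ.2.2.1 τ
    ⟨hσ.1, hσ.2.1, (mem_chains.mp hw τ (Finsupp.mem_support_iff.mp hτ)).1, h.1, h.2⟩

/-- A relative cycle without unmatched simplices is homologous to a chain of `L`. -/
lemma IsMatched.exists_sub_boundary_mem (h : IsMatched L M) {q : ℕ} (z : Finset ι →₀ F)
    (hz : z ∈ chains F M q) (hb : ∀ ν ∉ L, boundary F z ν = 0)
    (hu : ∀ α ∈ unmatched L M, z α = 0) :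
    ∃ w ∈ chains F M (q + 1), z - boundary F w ∈ chains F L q := by
  classical
  induction hn : (z.support.filter (· ∉ L)).card using Nat.strong_induction_on generalizing z with
  | _ n ih =>
  subst hn
  by_cases hL : ∀ σ ∈ z.support, σ ∈ L
  · refine ⟨0, zero_mem _, ?_⟩
    rw [map_zero, sub_zero, mem_chains]
    exact fun σ hσ => ⟨hL σ (Finsupp.mem_support_iff.mpr hσ), (mem_chains.mp hz σ hσ).2⟩
  push Not at hL
  obtain ⟨σ, hσz, hσL⟩ := hL
  have hσ0 := Finsupp.mem_support_iff.mp hσz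
  obtain ⟨hσM, hσc⟩ := mem_chains.mp hz σ hσ0
  by_cases hdown : ∃ ν, NewFacet L M ν σ
  · obtain ⟨ν, hν⟩ := hdown
    exfalso
    -- By `up`, `σ` is the only cofacet of `ν` in `M`, so the coefficient of `∂z` at `ν` is `± z σ ≠
    -- 0`.
    have := hb ν hν.2.1
    rw [boundary_apply, Finsupp.sum, Finset.sum_eq_single_of_mem σ hσz] at this
    · exact mul_ne_zero hσ0 (simplexBoundary_apply_ne_zero (nonempty_of_mem hν.1) hν.2.2.2.1
        hν.2.2.2.2) this
    · intro τ hτ hne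
      rw [simplexBoundary_apply_eq_zero, mul_zero]
      exact fun hs => hne (h.up ⟨hν.1, hν.2.1,
        (mem_chains.mp hz τ (Finsupp.mem_support_iff.mp hτ)).1, hs.1, hs.2⟩ hν)
  obtain ⟨τ, hτ⟩ : ∃ τ, NewFacet L M σ τ := by
    by_contra hup
    push Not at hup hdown
    exact hσ0 (hu σ ⟨hσM, hσL, hup, hdown⟩)
  have hτc : τ.card = (q + 1) + 1 := by rw [hτ.2.2.2.2, hσc]
  have hτM := single_mem_chains (F := F) hτ.2.2.1 hτc
  have he : simplexBoundary F τ σ ≠ 0 :=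
    simplexBoundary_apply_ne_zero (nonempty_of_mem hσM) hτ.2.2.2.1 hτ.2.2.2.2
  -- This multiple of `∂τ` cancels `σ`. By `down`, `σ` is the only facet of `τ` outside `L`, so no
  -- other coefficient outside `L` changes and the induction measure drops.
  set a := z σ / simplexBoundary F τ σ with ha
  have hother : ∀ α, α ∉ L → α ≠ σ → simplexBoundary F τ α = 0 := by
    intro α hα hne
    by_contra h0
    have hs : α ⊆ τ ∧ τ.card = α.card + 1 := by
      by_contra hs; exact h0 (simplexBoundary_apply_eq_zero hs)
    have hαne : α.Nonempty := by rw [← Finset.card_pos]; omega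
    exact hne (h.down ⟨mem_of_subset hτ.2.2.1 hs.1 hαne, hα, hτ.2.2.1, hs.1, hs.2⟩ hτ)
  set z' := z - a • simplexBoundary F τ with hz'
  have hz'σ : z' σ = 0 := by
    simp [hz', ha, he]
  have hz'o : ∀ α, α ∉ L → α ≠ σ → z' α = z α := by
    intro α h1 h2; simp [hz', hother α h1 h2]
  have hsub : simplexBoundary F τ ∈ chains F M q := by
    rw [← boundary_single]; exact (boundary_mem_cycles hτM).1
  have hlt : z'.support.filter (· ∉ L) ⊂ z.support.filter (· ∉ L) := by
    refine (Finset.ssubset_iff_of_subset fun α hα => ?_).mpr ⟨σ, by simp [hσ0, hσL], by simp [hz'σ]⟩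
    simp only [Finset.mem_filter, Finsupp.mem_support_iff] at hα ⊢
    have hne : α ≠ σ := fun e => hα.1 (e ▸ hz'σ)
    exact ⟨hz'o α hα.2 hne ▸ hα.1, hα.2⟩
  have hb' : ∀ ν ∉ L, boundary F z' ν = 0 := fun ν hν => by
    rw [hz', map_sub, map_smul, boundary_simplexBoundary, smul_zero, sub_zero, hb ν hν]
  have hu' : ∀ α ∈ unmatched L M, z' α = 0 := fun α hα => by
    rw [hz'o α hα.2.1 (fun e => hα.2.2.1 τ (e ▸ hτ)), hu α hα]
  obtain ⟨w, hw, hw'⟩ := ih _ (Finset.card_lt_card hlt) z'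
    (sub_mem hz (Submodule.smul_mem _ _ hsub)) hb' hu' rfl
  refine ⟨w + a • Finsupp.single τ 1, add_mem hw (Submodule.smul_mem _ _ hτM), ?_⟩
  rwa [map_add, map_smul, boundary_single, ← sub_sub, sub_right_comm]

end ChainLevel

/-! ### Effect on homology of adding matched pairs and one unmatched simplex. -/

section HomologyLevel

variable {F : Type*} [Field F] {ι : Type*} [LinearOrder ι] {L M : PreAbstractSimplicialComplex ι}
  {q : ℕ}

/-- The homology class of a cycle. -/
noncomputable def homologyClass (M : PreAbstractSimplicialComplex ι) (q : ℕ) :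
    cycles F M q →ₗ[F] Homology F M q :=
  Submodule.mkQ _

lemma homologyClass_surjective : Function.Surjective (homologyClass (F := F) M q) :=
  Submodule.mkQ_surjective _

lemma homologyClass_eq_zero {z : cycles F M q} :
    homologyClass M q z = 0 ↔ (z : Finset ι →₀ F) ∈ boundaries F M q := by
  rw [homologyClass, Submodule.mkQ_apply, Submodule.Quotient.mk_eq_zero]
  rfl

lemma homologyMap_homologyClass (h : L ≤ M) (z : cycles F L q) :
    homologyMap F h q (homologyClass L q z) =
      homologyClass M q ⟨z, cycles_mono F h q z.2⟩ := rfl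

lemma homologyMap_comp {N : PreAbstractSimplicialComplex ι} (h : L ≤ M) (h' : M ≤ N)
    (x : Homology F L q) :
    homologyMap F h' q (homologyMap F h q x) = homologyMap F (h.trans h') q x := by
  obtain ⟨z, rfl⟩ := homologyClass_surjective x
  rfl

lemma finite_homology (hM : M.faces.Finite) : Module.Finite F (Homology F M q) := by
  have := finite_chains (F := F) (q := q) hM
  have : Module.Finite F (cycles F M q) := Submodule.finiteDimensional_of_le inf_le_left
  infer_instance

/-- Rank-nullity for the map induced by an inclusion. -/
lemma finrank_homology_eq (hL : L.faces.Finite) (h : L ≤ M) :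
    Module.finrank F (LinearMap.range (homologyMap F h q)) +
      Module.finrank F (LinearMap.ker (homologyMap F h q)) = Module.finrank F (Homology F L q) := by
  have := finite_homology (F := F) (q := q) hL
  exact LinearMap.finrank_range_add_finrank_ker _

lemma IsMatched.mem_range (h : IsMatched L M) (z : cycles F M q)
    (hz : ∀ α ∈ unmatched L M, (z : Finset ι →₀ F) α = 0) :
    homologyClass M q z ∈ LinearMap.range (homologyMap F h.le q) := by
  obtain ⟨w, hw, hw'⟩ := h.exists_sub_boundary_mem z.1 z.2.1
    (fun ν _ => by rw [LinearMap.mem_ker.mp z.2.2]; rfl) hz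
  have hc : z.1 - boundary F w ∈ cycles F L q := by
    refine ⟨hw', ?_⟩
    rw [SetLike.mem_coe, LinearMap.mem_ker, map_sub, boundary_boundary, LinearMap.mem_ker.mp z.2.2, sub_zero]
  refine ⟨homologyClass L q ⟨_, hc⟩, ?_⟩
  rw [homologyMap_homologyClass, ← sub_eq_zero, ← map_sub, homologyClass_eq_zero]
  simpa using neg_mem (boundary_mem_boundaries hw)

/-- A cycle of `L` that bounds a chain of `M` without unmatched simplices bounds in `L`. -/
lemma IsMatched.boundary_mem (h : IsMatched L M) {w : Finset ι →₀ F}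
    (hw : w ∈ chains F M (q + 1)) (hb : boundary F w ∈ cycles F L q)
    (hz : ∀ α ∈ unmatched L M, w α = 0) : boundary F w ∈ boundaries F L q := by
  obtain ⟨u, -, hu⟩ := h.exists_sub_boundary_mem w hw
    (fun ν hν => by_contra fun h0 => hν (mem_chains.mp hb.1 ν h0).1) hz
  refine ⟨_, hu, ?_⟩
  rw [map_sub, boundary_boundary, sub_zero]

lemma IsMatched.range_eq_top (h : IsMatched L M)
    (hu : ∀ α ∈ unmatched L M, α.card ≠ q + 1) :
    LinearMap.range (homologyMap F h.le q) = ⊤ := by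
  rw [eq_top_iff]
  rintro x -
  obtain ⟨z, rfl⟩ := homologyClass_surjective x
  exact h.mem_range z fun α hα => by_contra fun h0 => hu α hα (mem_chains.mp z.2.1 α h0).2

/-- The bound is `q + 2` because a class of `H_q` dies by bounding a `(q+1)`-chain, whose simplices
have `q + 2` vertices. -/
lemma IsMatched.ker_eq_bot (h : IsMatched L M)
    (hu : ∀ α ∈ unmatched L M, α.card ≠ q + 2) :
    LinearMap.ker (homologyMap F h.le q) = ⊥ := by
  rw [eq_bot_iff]
  intro x hx
  obtain ⟨z, rfl⟩ := homologyClass_surjective x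
  rw [LinearMap.mem_ker, homologyMap_homologyClass, homologyClass_eq_zero] at hx
  obtain ⟨w, hw, hwz⟩ := hx
  rw [Submodule.mem_bot, homologyClass_eq_zero]
  dsimp only at hwz
  have hz := z.2
  rw [← hwz] at hz ⊢
  exact h.boundary_mem hw hz fun α hα => by_contra fun h0 => hu α hα (mem_chains.mp hw α h0).2

/-- The coefficient of a homology class at an unmatched simplex. -/
noncomputable def coeff {σ : Finset ι} (hσ : σ ∈ unmatched L M) (q : ℕ) :
    Homology F M q →ₗ[F] F :=
  Submodule.liftQ _ ((Finsupp.lapply σ).comp (cycles F M q).subtype) fun z hz => by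
    obtain ⟨w, hw, hwz⟩ := hz
    change (z : Finset ι →₀ F) σ = 0
    change boundary F w = z at hwz
    rw [← hwz]
    exact boundary_apply_of_unmatched hσ hw

lemma coeff_homologyClass {σ : Finset ι} (hσ : σ ∈ unmatched L M) (z : cycles F M q) :
    coeff hσ q (homologyClass M q z) = (z : Finset ι →₀ F) σ := rfl

/-- Exactness at `H_q(M)` in the sequence of the pair, with `coeff` in place of the map to relative
homology. The dimension of `σ` is not prescribed: when it differs from `q`, `coeff` is zero. -/
lemma IsMatched.ker_coeff (h : IsMatched L M) {σ : Finset ι} (hσ : σ ∈ unmatched L M)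
    (hu : ∀ α ∈ unmatched L M, α = σ) :
    LinearMap.ker (coeff (F := F) hσ q) = LinearMap.range (homologyMap F h.le q) := by
  refine le_antisymm ?_ ?_
  · intro x hx
    obtain ⟨z, rfl⟩ := homologyClass_surjective x
    rw [LinearMap.mem_ker, coeff_homologyClass] at hx
    exact h.mem_range z fun α hα => hu α hα ▸ hx
  · rintro _ ⟨x, rfl⟩
    obtain ⟨z, rfl⟩ := homologyClass_surjective x
    rw [LinearMap.mem_ker, homologyMap_homologyClass, coeff_homologyClass]
    by_contra h0
    exact hσ.2.1 (mem_chains.mp z.2.1 σ h0).1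

lemma IsMatched.finrank_eq_add (h : IsMatched L M) (hM : M.faces.Finite) {σ : Finset ι}
    (hσ : σ ∈ unmatched L M) (hu : ∀ α ∈ unmatched L M, α = σ) :
    Module.finrank F (Homology F M q) =
      Module.finrank F (LinearMap.range (coeff (F := F) hσ q)) +
        Module.finrank F (LinearMap.range (homologyMap F h.le q)) := by
  have := finite_homology (F := F) (q := q) hM
  rw [← LinearMap.finrank_range_add_finrank_ker (coeff (F := F) hσ q), h.ker_coeff hσ hu]

lemma finrank_range_functional {V : Type*} [AddCommGroup V] [Module F V] {g : V →ₗ[F] F} (x : V)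
    (hx : g x ≠ 0) : Module.finrank F (LinearMap.range g) = 1 := by
  rw [LinearMap.range_eq_top.mpr (LinearMap.surjective fun h0 => hx (by simp [h0])), finrank_top,
    Module.finrank_self]

/-- A new vertex raises the rank of `H_0` by one. -/
lemma IsMatched.finrank_zero (h : IsMatched L M) (hM : M.faces.Finite) {σ : Finset ι}
    (hσ : σ ∈ unmatched L M) (hu : ∀ α ∈ unmatched L M, α = σ) (hc : σ.card = 1) :
    Module.finrank F (Homology F M 0) =
      1 + Module.finrank F (LinearMap.range (homologyMap F h.le 0)) := by
  rw [h.finrank_eq_add hM hσ hu]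
  have hz : Finsupp.single σ (1 : F) ∈ cycles F M 0 := by
    refine ⟨single_mem_chains hσ.1 hc, ?_⟩
    rw [SetLike.mem_coe, LinearMap.mem_ker, boundary_single, simplexBoundary, if_pos hc.le]
  rw [finrank_range_functional (homologyClass M 0 ⟨_, hz⟩)]
  rw [coeff_homologyClass]
  simp

/-- A new `(q+1)`-simplex either raises the rank of `H_{q+1}` or kills a class of `H_q`. -/
lemma IsMatched.finrank_succ (h : IsMatched L M) (hM : M.faces.Finite) {σ : Finset ι}
    (hσ : σ ∈ unmatched L M) (hu : ∀ α ∈ unmatched L M, α = σ) (hc : σ.card = q + 2) :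
    Module.finrank F (Homology F M (q + 1)) +
        Module.finrank F (LinearMap.ker (homologyMap F h.le q)) =
      1 + Module.finrank F (LinearMap.range (homologyMap F h.le (q + 1))) := by
  rw [h.finrank_eq_add hM hσ hu]
  have hσc : Finsupp.single σ (1 : F) ∈ chains F M (q + 1) := single_mem_chains hσ.1 hc
  -- The dichotomy is whether `σ` occurs in a cycle of `M`. If it does, that cycle removes `σ` from
  -- any bounding chain, so nothing of `L` is killed.
  by_cases hpos : ∃ z ∈ cycles F M (q + 1), z σ ≠ 0
  · obtain ⟨z, hz, hz0⟩ := hpos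
    rw [finrank_range_functional (homologyClass M (q + 1) ⟨z, hz⟩) hz0]
    have hker : LinearMap.ker (homologyMap F h.le q) = ⊥ := by
      rw [eq_bot_iff]
      intro x hx
      obtain ⟨y, rfl⟩ := homologyClass_surjective x
      rw [LinearMap.mem_ker, homologyMap_homologyClass, homologyClass_eq_zero] at hx
      obtain ⟨w, hw, hwy⟩ := hx
      rw [Submodule.mem_bot, homologyClass_eq_zero]
      have hwy' : boundary F (w - (w σ / z σ) • z) = y := by
        rw [map_sub, map_smul, LinearMap.mem_ker.mp hz.2, smul_zero, sub_zero, hwy]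
      have hy := y.2
      rw [← hwy'] at hy ⊢
      refine h.boundary_mem (sub_mem hw (Submodule.smul_mem _ _ hz.1)) hy fun α hα => ?_
      rw [hu α hα]
      simp [hz0]
    rw [hker, finrank_bot, add_zero]
  · push Not at hpos
    have hr : coeff (F := F) hσ (q + 1) = 0 := by
      refine LinearMap.ext fun x => ?_
      obtain ⟨z, rfl⟩ := homologyClass_surjective x
      exact hpos z z.2
    -- A facet of `σ` outside `L` would be matched with `σ`, so `∂σ` lies in `L`. Its class spans
    -- the kernel.
    have hLc : simplexBoundary F σ ∈ cycles F L q := by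
      have hMc := boundary_mem_cycles hσc
      rw [boundary_single] at hMc
      refine ⟨mem_chains.mpr fun ν hν => ?_, hMc.2⟩
      obtain ⟨hνM, hνc⟩ := mem_chains.mp hMc.1 ν hν
      refine ⟨by_contra fun hνL => ?_, hνc⟩
      have hs : ν ⊆ σ ∧ σ.card = ν.card + 1 := by
        by_contra hs; exact hν (simplexBoundary_apply_eq_zero hs)
      exact hσ.2.2.2 ν ⟨hνM, hνL, hσ.1, hs⟩
    have hne : homologyClass L q ⟨_, hLc⟩ ≠ 0 := by
      rw [Ne, homologyClass_eq_zero]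
      rintro ⟨l, hl, hle⟩
      have hl' := mem_chains.mp hl σ
      -- If `∂σ` bounded `l` in `L`, then `σ - l` would be a cycle with coefficient 1 at `σ`.
      have hz : Finsupp.single σ 1 - l ∈ cycles F M (q + 1) := by
        refine ⟨sub_mem hσc (chains_mono h.le _ hl), ?_⟩
        rw [SetLike.mem_coe, LinearMap.mem_ker, map_sub, boundary_single, hle, sub_self]
      have h0 := hpos _ hz
      have hl0 : l σ = 0 := by_contra fun h1 => hσ.2.1 (hl' h1).1
      simp [hl0] at h0
    have hker : LinearMap.ker (homologyMap F h.le q) =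
        Submodule.span F {homologyClass L q ⟨_, hLc⟩} := by
      refine le_antisymm ?_ ?_
      · intro x hx
        obtain ⟨y, rfl⟩ := homologyClass_surjective x
        rw [LinearMap.mem_ker, homologyMap_homologyClass, homologyClass_eq_zero] at hx
        obtain ⟨w, hw, hwy⟩ := hx
        refine Submodule.mem_span_singleton.mpr ⟨w σ, ?_⟩
        symm
        rw [← sub_eq_zero, ← map_smul, ← map_sub, homologyClass_eq_zero]
        have e : boundary F (w - w σ • Finsupp.single σ 1) =
            (y - w σ • (⟨_, hLc⟩ : cycles F L q) : cycles F L q) := by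
          rw [map_sub, map_smul, boundary_single, hwy]; rfl
        rw [← e]
        refine h.boundary_mem (sub_mem hw (Submodule.smul_mem _ _ hσc)) ?_ fun α hα => ?_
        · rw [e]; exact Subtype.prop _
        · rw [hu α hα]; simp
      · rw [Submodule.span_singleton_le_iff_mem, LinearMap.mem_ker, homologyMap_homologyClass,
          homologyClass_eq_zero]
        have := boundary_mem_boundaries hσc
        rwa [boundary_single] at this
    rw [hr, hker, finrank_span_singleton hne, LinearMap.range_zero, finrank_bot]
    omega

end HomologyLevel

/-! ### Discrete Morse functions match the new simplices at each value. -/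

section MorseStructure

variable {ι : Type*} {K : PreAbstractSimplicialComplex ι} {f : Finset ι → ℝ} {c : ℝ}

lemma mem_upperExceptions {σ τ : Finset ι} : τ ∈ upperExceptions K f σ ↔
    τ ∈ K ∧ σ ⊆ τ ∧ τ.card = σ.card + 1 ∧ f τ ≤ f σ := by
  simp only [upperExceptions, dim, Set.mem_ofPred_eq]
  have : ((τ.card : ℤ) - 1 = σ.card - 1 + 1) ↔ τ.card = σ.card + 1 := by omega
  rw [this]

lemma mem_lowerExceptions {σ ν : Finset ι} : ν ∈ lowerExceptions K f σ ↔
    ν ∈ K ∧ ν ⊆ σ ∧ σ.card = ν.card + 1 ∧ f σ ≤ f ν := by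
  simp only [lowerExceptions, dim, Set.mem_ofPred_eq]
  have : ((ν.card : ℤ) - 1 = σ.card - 1 - 1) ↔ σ.card = ν.card + 1 := by omega
  rw [this]

lemma sublevel_le : sublevel K f c ≤ K :=
  fun _ ⟨hne, _, hσ, _, hs⟩ => mem_of_subset hσ hs hne

lemma IsDiscreteMorse.eq_of_upper (hf : IsDiscreteMorse K f) {σ τ τ' : Finset ι} (hσ : σ ∈ K)
    (h : τ ∈ upperExceptions K f σ) (h' : τ' ∈ upperExceptions K f σ) : τ = τ' :=
  Set.encard_le_one_iff.mp (hf σ hσ).1 τ τ' h h'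

lemma IsDiscreteMorse.eq_of_lower (hf : IsDiscreteMorse K f) {σ ν ν' : Finset ι} (hσ : σ ∈ K)
    (h : ν ∈ lowerExceptions K f σ) (h' : ν' ∈ lowerExceptions K f σ) : ν = ν' :=
  Set.encard_le_one_iff.mp (hf σ hσ).2 ν ν' h h'

/-- If `ν` has codimension at least two in `ρ`, some facet of `ρ` other than `μ` contains `ν`. -/
lemma exists_facet_ne {ν ρ : Finset ι} (μ : Finset ι) (hs : ν ⊆ ρ)
    (hc : ν.card + 2 ≤ ρ.card) :
    ∃ μ', μ' ≠ μ ∧ ν ⊆ μ' ∧ μ' ⊆ ρ ∧ ρ.card = μ'.card + 1 := by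
  classical
  obtain ⟨v, w, hv, hw, hvw⟩ : ∃ v w, v ∈ ρ \ ν ∧ w ∈ ρ \ ν ∧ v ≠ w := by
    have : 1 < (ρ \ ν).card := by rw [Finset.card_sdiff_of_subset hs]; omega
    obtain ⟨v, hv, w, hw, h⟩ := Finset.one_lt_card.mp this
    exact ⟨v, w, hv, hw, h⟩
  have key : ∀ x ∈ ρ \ ν, ν ⊆ ρ.erase x ∧ ρ.erase x ⊆ ρ ∧ ρ.card = (ρ.erase x).card + 1 := by
    intro x hx
    rw [Finset.mem_sdiff] at hx
    exact ⟨fun y hy => Finset.mem_erase.mpr ⟨fun e => hx.2 (e ▸ hy), hs hy⟩,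
      Finset.erase_subset _ _, (Finset.card_erase_add_one hx.1).symm⟩
  by_cases h : ρ.erase v = μ
  · refine ⟨ρ.erase w, fun e => hvw ?_, key w hw⟩
    exact Finset.erase_injOn ρ (Finset.mem_sdiff.mp hv).1 (Finset.mem_sdiff.mp hw).1
      (h.trans e.symm)
  · exact ⟨ρ.erase v, h, key v hv⟩

/-- At least two facets of `ρ` contain `ν`, and at most one facet of `ρ` is a lower exception. -/
lemma IsDiscreteMorse.exists_facet_lt (hf : IsDiscreteMorse K f) {ν ρ : Finset ι} (hρ : ρ ∈ K)
    (hν : ν.Nonempty) (hs : ν ⊆ ρ) (hc : ν.card + 2 ≤ ρ.card) :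
    ∃ μ ∈ K, ν ⊆ μ ∧ μ ⊆ ρ ∧ ρ.card = μ.card + 1 ∧ f μ < f ρ := by
  obtain ⟨μ, -, h1, h2, h3⟩ := exists_facet_ne ∅ hs hc
  have hμ := mem_of_subset hρ h2 (hν.mono h1)
  by_cases h : f μ < f ρ
  · exact ⟨μ, hμ, h1, h2, h3, h⟩
  obtain ⟨μ', hne, h1', h2', h3'⟩ := exists_facet_ne μ hs hc
  have hμ' := mem_of_subset hρ h2' (hν.mono h1')
  refine ⟨μ', hμ', h1', h2', h3', lt_of_not_ge fun h' => hne ?_⟩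
  exact hf.eq_of_lower hρ (mem_lowerExceptions.mpr ⟨hμ', h2', h3', h'⟩)
    (mem_lowerExceptions.mpr ⟨hμ, h2, h3, not_lt.mp h⟩)

/-- A proper coface `ρ` of `ν` contains a coface of codimension one whose value is at most `f ρ`. -/
lemma IsDiscreteMorse.exists_cofacet_le (hf : IsDiscreteMorse K f) {ν ρ : Finset ι} (hρ : ρ ∈ K)
    (hν : ν.Nonempty) (hs : ν ⊂ ρ) :
    ∃ τ ∈ K, ν ⊆ τ ∧ τ ⊆ ρ ∧ τ.card = ν.card + 1 ∧ f τ ≤ f ρ := by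
  induction hn : ρ.card using Nat.strong_induction_on generalizing ρ with
  | _ n ih =>
  subst hn
  have hlt := Finset.card_lt_card hs
  by_cases hc : ρ.card = ν.card + 1
  · exact ⟨ρ, hρ, hs.1, subset_rfl, hc, le_rfl⟩
  obtain ⟨μ, hμ, h1, h2, h3, h4⟩ := hf.exists_facet_lt hρ hν hs.1 (by omega)
  have hss : ν ⊂ μ := h1.ssubset_of_ne fun e => by rw [e] at hc; omega
  obtain ⟨τ, hτ, g1, g2, g3, g4⟩ := ih μ.card (by omega) hμ hss rfl
  exact ⟨τ, hτ, g1, g2.trans h2, g3, g4.trans h4.le⟩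

lemma le_of_notMem_sublevelLT {σ : Finset ι} (hσ : σ ∈ K) (h : σ ∉ sublevelLT K f c) : c ≤ f σ :=
  le_of_not_gt fun hlt => h ⟨nonempty_of_mem hσ, σ, hσ, hlt, subset_rfl⟩

lemma notMem_sublevelLT_of_subset {σ τ : Finset ι} (hσ : σ.Nonempty) (hs : σ ⊆ τ)
    (h : σ ∉ sublevelLT K f c) : τ ∉ sublevelLT K f c :=
  fun hτ => h (mem_of_subset hτ hs hσ)

lemma mem_sublevel_of_le {σ : Finset ι} (hσ : σ ∈ K) (h : f σ ≤ c) : σ ∈ sublevel K f c :=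
  ⟨nonempty_of_mem hσ, σ, hσ, h, subset_rfl⟩

/-- A new simplex whose value is not `c` has a cofacet of value `c`. -/
lemma IsDiscreteMorse.exists_cofacet_eq (hf : IsDiscreteMorse K f) {α : Finset ι}
    (hα : α ∈ sublevel K f c) (hα' : α ∉ sublevelLT K f c) (hne : f α ≠ c) :
    ∃ τ ∈ K, α ⊆ τ ∧ τ.card = α.card + 1 ∧ f τ = c := by
  obtain ⟨hn, ρ, hρ, hρc, hs⟩ := hα
  have hle := le_of_notMem_sublevelLT (mem_of_subset hρ hs hn) hα'
  -- Here `f α > c`, so `α` enters only as a proper face of `ρ`. A cofacet of `α` inside `ρ` has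
  -- value at most `c`, and at least `c` because it is new.
  have hss : α ⊂ ρ := hs.ssubset_of_ne fun e => hne (le_antisymm (e ▸ hρc) hle)
  obtain ⟨τ, hτ, h1, -, h3, h4⟩ := hf.exists_cofacet_le hρ hn hss
  exact ⟨τ, hτ, h1, h3, le_antisymm (h4.trans hρc)
    (le_of_notMem_sublevelLT hτ (notMem_sublevelLT_of_subset hn h1 hα'))⟩

/-- The larger simplex of a new pair has value `c`. -/
lemma IsDiscreteMorse.eq_of_newFacet (hf : IsDiscreteMorse K f) {σ τ : Finset ι}
    (h : NewFacet (sublevelLT K f c) (sublevel K f c) σ τ) : f τ = c := by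
  obtain ⟨hσ, hσ', hτ, hs, hc⟩ := h
  have hn := nonempty_of_mem hσ
  by_contra hne
  have hτ' := notMem_sublevelLT_of_subset hn hs hσ'
  -- `σ` has codimension two in this `ρ` of value `c`, so it lies in a facet of `ρ` of smaller value
  -- and is not new.
  obtain ⟨ρ, hρ, h1, h2, h3⟩ := hf.exists_cofacet_eq hτ hτ' hne
  obtain ⟨μ, hμ, g1, -, -, g4⟩ := hf.exists_facet_lt hρ hn (hs.trans h1) (by omega)
  exact hσ' ⟨hn, μ, hμ, h3 ▸ g4, g1⟩

lemma IsDiscreteMorse.upper_of_newFacet (hf : IsDiscreteMorse K f) {σ τ : Finset ι}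
    (h : NewFacet (sublevelLT K f c) (sublevel K f c) σ τ) : τ ∈ upperExceptions K f σ :=
  mem_upperExceptions.mpr ⟨sublevel_le h.2.2.1, h.2.2.2.1, h.2.2.2.2, (hf.eq_of_newFacet h).trans_le
    (le_of_notMem_sublevelLT (sublevel_le h.1) h.2.1)⟩

lemma IsDiscreteMorse.lower_of_newFacet (hf : IsDiscreteMorse K f) {σ τ : Finset ι}
    (h : NewFacet (sublevelLT K f c) (sublevel K f c) σ τ) : σ ∈ lowerExceptions K f τ :=
  mem_lowerExceptions.mpr ⟨sublevel_le h.1, h.2.2.2.1, h.2.2.2.2, (hf.eq_of_newFacet h).trans_le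
    (le_of_notMem_sublevelLT (sublevel_le h.1) h.2.1)⟩

lemma IsDiscreteMorse.isMatched (hf : IsDiscreteMorse K f) (c : ℝ) :
    IsMatched (sublevelLT K f c) (sublevel K f c) where
  le := sublevelLT_le
  up _ _ _ h h' := hf.eq_of_upper (sublevel_le h.1) (hf.upper_of_newFacet h)
    (hf.upper_of_newFacet h')
  down _ _ _ h h' := hf.eq_of_lower (sublevel_le h.2.2.1) (hf.lower_of_newFacet h)
    (hf.lower_of_newFacet h')

/-- The unmatched new simplices at the value `c` are the critical simplices of value `c`. -/
lemma IsDiscreteMorse.mem_unmatched (hf : IsDiscreteMorse K f) {α : Finset ι} :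
    α ∈ unmatched (sublevelLT K f c) (sublevel K f c) ↔ IsCritical K f α ∧ f α = c := by
  constructor
  · rintro ⟨hα, hα', hup, hdown⟩
    have hn := nonempty_of_mem hα
    have hK : α ∈ K := sublevel_le hα
    have hc : f α = c := by
      by_contra hne
      obtain ⟨τ, hτ, h1, h2, h3⟩ := hf.exists_cofacet_eq hα hα' hne
      exact hup τ ⟨hα, hα', mem_sublevel_of_le hτ h3.le, h1, h2⟩
    refine ⟨⟨hK, ?_, ?_⟩, hc⟩
    · refine Set.eq_empty_iff_forall_notMem.mpr fun τ hτ => ?_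
      obtain ⟨h1, h2, h3, h4⟩ := mem_upperExceptions.mp hτ
      exact hup τ ⟨hα, hα', mem_sublevel_of_le h1 (h4.trans hc.le), h2, h3⟩
    · refine Set.eq_empty_iff_forall_notMem.mpr fun ν hν => ?_
      obtain ⟨h1, h2, h3, h4⟩ := mem_lowerExceptions.mp hν
      have hνn := nonempty_of_mem h1
      refine hdown ν ⟨mem_of_subset hα h2 hνn, ?_, hα, h2, h3⟩
      -- If `ν` were old, it would have a cofacet `τ` of value below `c`. Both `τ` and `α` would be
      -- upper exceptions of `ν`, hence equal, although `f α = c`.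
      rintro ⟨-, ρ, hρ, hρc, hs⟩
      have hss : ν ⊂ ρ := hs.ssubset_of_ne fun e => by subst e; linarith
      obtain ⟨τ, hτ, g1, g2, g3, g4⟩ := hf.exists_cofacet_le hρ hνn hss
      have : τ = α := hf.eq_of_upper h1
        (mem_upperExceptions.mpr ⟨hτ, g1, g3, by linarith⟩)
        (mem_upperExceptions.mpr ⟨hK, h2, h3, h4⟩)
      subst this
      linarith
  · rintro ⟨⟨hK, hup, hlow⟩, hc⟩
    refine ⟨mem_sublevel_of_le hK hc.le, ?_, fun τ hτ => ?_, fun ν hν => ?_⟩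
    · rintro ⟨hn, ρ, hρ, hρc, hs⟩
      have hss : α ⊂ ρ := hs.ssubset_of_ne fun e => by subst e; linarith
      obtain ⟨τ, hτ, g1, g2, g3, g4⟩ := hf.exists_cofacet_le hρ hn hss
      exact Set.eq_empty_iff_forall_notMem.mp hup τ
        (mem_upperExceptions.mpr ⟨hτ, g1, g3, by linarith⟩)
    · exact Set.eq_empty_iff_forall_notMem.mp hup τ (hf.upper_of_newFacet hτ)
    · exact Set.eq_empty_iff_forall_notMem.mp hlow ν (hf.lower_of_newFacet hν)

end MorseStructure

/-! ### Consecutive values of the filtration. -/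

section Values

variable {ι : Type*} {K : PreAbstractSimplicialComplex ι} {f : Finset ι → ℝ} {c : ℝ} {q : ℕ}

/-- `K(<c)` is either empty or `K(b)` for the greatest value `b < c`. -/
lemma exists_preceding_value (hK : K.faces.Finite) (f : Finset ι → ℝ) (c : ℝ) :
    (∀ σ ∈ K, ¬ f σ < c) ∨ ∃ σ ∈ K, f σ < c ∧ (∀ ρ ∈ K, f ρ < c → f ρ ≤ f σ) ∧
      sublevelLT K f c = sublevel K f (f σ) := by
  by_cases h : ∃ σ ∈ K, f σ < c
  · right
    obtain ⟨σ, hσ, hmax⟩ := (Set.Finite.subset (t := {σ | σ ∈ K ∧ f σ < c}) hK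
      fun _ h => h.1).exists_maximalFor f _ h
    have hmax' : ∀ ρ ∈ K, f ρ < c → f ρ ≤ f σ := fun ρ hρ hρc =>
      (le_total (f ρ) (f σ)).elim id fun h => hmax ⟨hρ, hρc⟩ h
    refine ⟨σ, hσ.1, hσ.2, hmax', le_antisymm ?_ (sublevel_le_sublevelLT hσ.2)⟩
    rintro τ ⟨hn, ρ, hρ, hρc, hs⟩
    exact ⟨hn, ρ, hρ, hmax' ρ hρ hρc, hs⟩
  · left
    push Not at h ⊢
    exact h

lemma finite_sublevel (hK : K.faces.Finite) (c : ℝ) : (sublevel K f c).faces.Finite :=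
  hK.subset fun _ h => sublevel_le h

lemma finite_sublevelLT (hK : K.faces.Finite) (c : ℝ) : (sublevelLT K f c).faces.Finite :=
  (finite_sublevel hK c).subset fun _ h => sublevelLT_le h

lemma eq_of_mem_unmatched (hf : IsDiscreteMorse K f) (hexc : IsExcellent K f) {σ : Finset ι}
    (hσ : σ ∈ unmatched (sublevelLT K f c) (sublevel K f c)) :
    ∀ α ∈ unmatched (sublevelLT K f c) (sublevel K f c), α = σ := by
  intro α hα
  obtain ⟨h1, h2⟩ := hf.mem_unmatched.mp hα
  obtain ⟨h3, h4⟩ := hf.mem_unmatched.mp hσ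
  exact hexc h1 h3 (h2.trans h4.symm)

lemma dim_eq_iff {σ : Finset ι} : dim σ = q ↔ σ.card = q + 1 := by
  rw [dim]; omega

end Values

/-! ### Homology along one step of the filtration. -/

section Filtration

variable {F : Type*} [Field F] {ι : Type*} [LinearOrder ι] {K : PreAbstractSimplicialComplex ι}
  {f : Finset ι → ℝ} {c : ℝ} {q : ℕ}

lemma subsingleton_homology (hc : ∀ σ ∈ K, ¬ f σ < c) :
    Subsingleton (Homology F (sublevelLT K f c) q) := by
  refine subsingleton_of_forall_eq 0 fun x => ?_
  obtain ⟨z, rfl⟩ := homologyClass_surjective x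
  rw [show z = 0 from Subtype.ext <| Finsupp.ext fun σ => by_contra fun h0 => ?_, map_zero]
  obtain ⟨-, ρ, hρ, hρc, -⟩ := (mem_chains.mp z.2.1 σ h0).1
  exact hc ρ hρ hρc

lemma exists_critical_of_range_ne_top (hf : IsDiscreteMorse K f)
    (h : LinearMap.range (homologyMap F (sublevelLT_le (K := K) (f := f) (c := c)) q) ≠ ⊤) :
    ∃ σ, IsCritical K f σ ∧ f σ = c ∧ σ.card = q + 1 := by
  by_contra! hno
  refine h ((hf.isMatched c).range_eq_top fun α hα => ?_)
  obtain ⟨h1, h2⟩ := hf.mem_unmatched.mp hα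
  exact hno α h1 h2

lemma exists_critical_of_ker_ne_bot (hf : IsDiscreteMorse K f)
    (h : LinearMap.ker (homologyMap F (sublevelLT_le (K := K) (f := f) (c := c)) q) ≠ ⊥) :
    ∃ σ, IsCritical K f σ ∧ f σ = c ∧ σ.card = q + 2 := by
  by_contra! hno
  refine h ((hf.isMatched c).ker_eq_bot fun α hα => ?_)
  obtain ⟨h1, h2⟩ := hf.mem_unmatched.mp hα
  exact hno α h1 h2

/-- The image in degree `q + 1` is at most all of `H_{q+1}(K(c))`, so the balance in
`IsMatched.finrank_succ` leaves at most 1 for the kernel. -/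
lemma finrank_ker_le_one (hK : K.faces.Finite) (hf : IsDiscreteMorse K f)
    (hexc : IsExcellent K f) :
    Module.finrank F
      (LinearMap.ker (homologyMap F (sublevelLT_le (K := K) (f := f) (c := c)) q)) ≤ 1 := by
  by_cases h : LinearMap.ker (homologyMap F (sublevelLT_le (K := K) (f := f) (c := c)) q) = ⊥
  · rw [h, finrank_bot]; omega
  obtain ⟨σ, h1, h2, h3⟩ := exists_critical_of_ker_ne_bot hf h
  have hσ := hf.mem_unmatched.mpr ⟨h1, h2⟩
  have e := (hf.isMatched c).finrank_succ (F := F) (finite_sublevel hK c) hσ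
    (eq_of_mem_unmatched hf hexc hσ) h3
  have := finite_homology (F := F) (q := q + 1) (finite_sublevel (f := f) hK c)
  have := Submodule.finrank_le
    (LinearMap.range (homologyMap F (sublevelLT_le (K := K) (f := f) (c := c)) (q + 1)))
  omega

end Filtration

/-! ### Persistence pairs counted by kernels, and the telescoping sum. -/

section Pairs

variable {F : Type*} [Field F] {ι : Type*} [LinearOrder ι] {K : PreAbstractSimplicialComplex ι}
  {f : Finset ι → ℝ} {c : ℝ} {q : ℕ}

variable (F) in
/-- The finite persistence pairs with birth simplex of dimension `q` and death value `c`. -/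
def pairsAt (K : PreAbstractSimplicialComplex ι) (f : Finset ι → ℝ) (q : ℤ) (c : ℝ) :
    Set (Finset ι × Finset ι) :=
  {P | P ∈ finitePairs F K f q ∧ f P.2 = c}

/-- The critical `q`-simplices of value `c`. -/
def criticalAt (K : PreAbstractSimplicialComplex ι) (f : Finset ι → ℝ) (q : ℤ) (c : ℝ) :
    Set (Finset ι) :=
  {σ | σ ∈ criticalSimplices K f q ∧ f σ = c}

/-- A birth in degree `q` means non-surjectivity there, which needs a critical `q`-simplex of that
value; by excellence it is `σ`. So the free degree in `IsPersistencePair` is the dimension of the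
birth simplex. -/
lemma card_eq_of_isBornAt (hf : IsDiscreteMorse K f) (hexc : IsExcellent K f) {σ : Finset ι}
    (hσ : IsCritical K f σ) {x : Homology F (sublevel K f (f σ)) q}
    (hx : IsBornAt F K f (f σ) x) : σ.card = q + 1 := by
  obtain ⟨σ', h1, h2, h3⟩ := exists_critical_of_range_ne_top (F := F) (q := q) (c := f σ) hf
    fun h => hx (h ▸ Submodule.mem_top)
  rwa [← hexc h1 hσ h2]

/-- The death simplex of a pair kills a class that comes from the birth value, but not from the
preceding step. -/
lemma exists_mem_ker_of_isPersistencePair (hf : IsDiscreteMorse K f) (hexc : IsExcellent K f)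
    {σ τ : Finset ι} (hP : IsPersistencePair F K f σ τ) (hd : dim σ = q) :
    ∃ hlt : f σ < f τ,
      ∃ z ∈ LinearMap.ker (homologyMap F (sublevelLT_le (K := K) (f := f) (c := f τ)) q),
        z ∈ LinearMap.range (homologyMap F (sublevel_le_sublevelLT (K := K) hlt) q) ∧
        z ∉ LinearMap.range (homologyMap F
          ((sublevelLT_le (K := K) (f := f)).trans (sublevel_le_sublevelLT hlt)) q) := by
  obtain ⟨hσ, hτ, hlt, p, x, hborn, hdies⟩ := hP
  obtain rfl : p = q := by
    have := card_eq_of_isBornAt hf hexc hσ hborn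
    have := dim_eq_iff.mp hd
    omega
  obtain ⟨h1, y, hy⟩ := hdies
  set j := homologyMap F (sublevel_le_sublevelLT (K := K) hlt) p
  set i := homologyMap F ((sublevelLT_le (K := K) (f := f)).trans (sublevel_le_sublevelLT hlt)) p
  refine ⟨hlt, j x - i y, ?_, ⟨x - homologyMap F sublevelLT_le p y, ?_⟩, fun h => h1 ?_⟩
  · rw [LinearMap.mem_ker, map_sub, homologyMap_comp, homologyMap_comp, sub_eq_zero]
    exact hy.symm
  · rw [map_sub, homologyMap_comp]
  · simpa using add_mem h (LinearMap.mem_range_self i y)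

/-- A class killed at `c` gives a persistence pair with death value `c`. -/
lemma exists_mem_pairsAt (hK : K.faces.Finite) (hf : IsDiscreteMorse K f)
    (h : LinearMap.ker (homologyMap F (sublevelLT_le (K := K) (f := f) (c := c)) q) ≠ ⊥) :
    ∃ P, P ∈ pairsAt F K f q c := by
  obtain ⟨τ, hτ, rfl, -⟩ := exists_critical_of_ker_ne_bot hf h
  obtain ⟨z, hz, hz0⟩ := Submodule.exists_mem_ne_zero_of_ne_bot h
  -- The birth value is the least value from whose sublevel complex `z` comes. `hprec` shows that
  -- coming from `K(<b)` means coming from an earlier value, since `z ≠ 0`.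
  let S : Set (Finset ι) := {σ | σ ∈ K ∧ ∃ hlt : f σ < f τ,
    z ∈ LinearMap.range (homologyMap F (sublevel_le_sublevelLT (K := K) hlt) q)}
  have hprec : ∀ (b : ℝ) (hb : sublevelLT K f b ≤ sublevelLT K f (f τ)), b ≤ f τ →
      z ∈ LinearMap.range (homologyMap F hb q) → ∃ σ ∈ S, f σ < b := by
    rintro b hb hbτ ⟨y, hy⟩
    obtain he | ⟨σ, hσ, hσb, -, he⟩ := exists_preceding_value hK f b
    · have := subsingleton_homology (F := F) (q := q) he
      rw [Subsingleton.elim y 0, map_zero] at hy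
      exact absurd hy.symm hz0
    · refine ⟨σ, ⟨hσ, hσb.trans_le hbτ, homologyMap F he.le q y, ?_⟩, hσb⟩
      rw [homologyMap_comp, hy]
  have hS : S.Nonempty := by
    obtain ⟨σ, hσ, -⟩ := hprec (f τ) le_rfl le_rfl ⟨z, by
      obtain ⟨w, rfl⟩ := homologyClass_surjective z
      rfl⟩
    exact ⟨σ, hσ⟩
  obtain ⟨σ, ⟨hσ, hlt, x, hx⟩, hmin⟩ :=
    (Set.Finite.subset (t := S) hK fun _ h => h.1).exists_minimalFor f _ hS
  have hnot : z ∉ LinearMap.range (homologyMap F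
      ((sublevelLT_le (K := K) (f := f)).trans (sublevel_le_sublevelLT hlt)) q) := by
    intro hr
    obtain ⟨ρ, hρ, hρσ⟩ := hprec (f σ) _ hlt.le hr
    exact absurd (hmin hρ hρσ.le) (not_le.mpr hρσ)
  have hborn : IsBornAt F K f (f σ) x := by
    rintro ⟨y, rfl⟩
    rw [homologyMap_comp] at hx
    exact hnot ⟨y, hx⟩
  -- The minimizer `σ` need not be critical; it is replaced by the critical simplex with the same
  -- value.
  obtain ⟨σ', h1, h2, h3⟩ := exists_critical_of_range_ne_top (F := F) (q := q) (c := f σ) hf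
    fun h => hborn (h ▸ Submodule.mem_top)
  have hpair : ∀ b, f σ' = b → ∀ (hb : b < f τ) (x : Homology F (sublevel K f b) q),
      IsBornAt F K f b x → DiesAt F K f hb x → IsPersistencePair F K f σ' τ := by
    rintro _ rfl hb x hx hx'
    exact ⟨h1, hτ, hb, q, x, hx, hx'⟩
  -- Since `z` becomes zero at `f τ`, the elder class `0` witnesses the death.
  refine ⟨(σ', τ), ⟨hpair _ h2 hlt x hborn ⟨hx ▸ hnot, 0, ?_⟩, dim_eq_iff.mpr h3⟩, rfl⟩
  rw [map_zero, ← homologyMap_comp (sublevel_le_sublevelLT hlt) sublevelLT_le, hx]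
  exact (LinearMap.mem_ker.mp hz).symm

/-- The killed classes of two such pairs are proportional, as the kernel is a line. The class of the
earlier birth comes from below the later birth value, hence so would the other one, which is
excluded. -/
lemma subsingleton_pairsAt (hK : K.faces.Finite) (hf : IsDiscreteMorse K f)
    (hexc : IsExcellent K f) : (pairsAt F K f q c).Subsingleton := by
  have key : ∀ {σ σ' τ : Finset ι}, IsPersistencePair F K f σ τ → IsPersistencePair F K f σ' τ →
      dim σ = q → dim σ' = q → ¬ f σ < f σ' := by
    intro σ σ' τ hP hP' hd hd' hσσ'
    obtain ⟨hlt, z, hz, ⟨x, hx⟩, hz1⟩ := exists_mem_ker_of_isPersistencePair hf hexc hP hd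
    obtain ⟨hlt', z', hz', -, hz1'⟩ := exists_mem_ker_of_isPersistencePair hf hexc hP' hd'
    have := finite_homology (F := F) (q := q) (finite_sublevelLT (f := f) hK (f τ))
    have hz0 : (⟨z, hz⟩ : LinearMap.ker _) ≠ 0 := fun h0 => hz1 (by
      rw [show z = 0 from congrArg Subtype.val h0]; exact zero_mem _)
    have h1 : Module.finrank F
        (LinearMap.ker (homologyMap F (sublevelLT_le (K := K) (f := f) (c := f τ)) q)) = 1 :=
      le_antisymm (finrank_ker_le_one hK hf hexc)
        (Module.finrank_pos_iff_exists_ne_zero.mpr ⟨_, hz0⟩)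
    obtain ⟨a, ha⟩ := (finrank_eq_one_iff_of_nonzero' _ hz0).mp h1 ⟨z', hz'⟩
    have ha' : a • z = z' := congrArg Subtype.val ha
    refine hz1' ?_
    rw [← ha', ← hx]
    refine Submodule.smul_mem _ _ ⟨homologyMap F (sublevel_le_sublevelLT hσσ') q x, ?_⟩
    rw [homologyMap_comp]
  rintro ⟨σ, τ⟩ ⟨⟨hP, hd⟩, hc⟩ ⟨σ', τ'⟩ ⟨⟨hP', hd'⟩, hc'⟩
  dsimp only at *
  obtain rfl : τ = τ' := hexc hP.2.1 hP'.2.1 (hc.trans hc'.symm)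
  obtain rfl : σ = σ' := hexc hP.1 hP'.1
    (le_antisymm (not_lt.mp (key hP' hP hd' hd)) (not_lt.mp (key hP hP' hd hd')))
  rfl

lemma ncard_pairsAt (hK : K.faces.Finite) (hf : IsDiscreteMorse K f) (hexc : IsExcellent K f) :
    (pairsAt F K f q c).ncard = Module.finrank F
      (LinearMap.ker (homologyMap F (sublevelLT_le (K := K) (f := f) (c := c)) q)) := by
  by_cases h : LinearMap.ker (homologyMap F (sublevelLT_le (K := K) (f := f) (c := c)) q) = ⊥
  · rw [h, finrank_bot]
    suffices he : pairsAt F K f q c = ∅ by rw [he, Set.ncard_empty]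
    refine Set.eq_empty_iff_forall_notMem.mpr ?_
    rintro ⟨σ, τ⟩ ⟨⟨hP, hd⟩, rfl⟩
    obtain ⟨hlt, z, hz, -, hz1⟩ := exists_mem_ker_of_isPersistencePair hf hexc hP hd
    dsimp only at *
    rw [h, Submodule.mem_bot] at hz
    exact hz1 (hz ▸ zero_mem _)
  · obtain ⟨P, hP⟩ := exists_mem_pairsAt hK hf h
    rw [(subsingleton_pairsAt hK hf hexc).eq_singleton_of_mem hP, Set.ncard_singleton]
    have := finite_homology (F := F) (q := q) (finite_sublevelLT (f := f) hK c)
    refine le_antisymm ?_ (finrank_ker_le_one hK hf hexc)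
    exact Submodule.one_le_finrank_iff.mpr h

lemma pairsAt_neg_one : pairsAt F K f (-1) c = ∅ := by
  refine Set.eq_empty_iff_forall_notMem.mpr ?_
  rintro ⟨σ, τ⟩ ⟨⟨hP, hd⟩, -⟩
  have := (nonempty_of_mem hP.1.1).card_pos
  change (σ.card : ℤ) - 1 = -1 at hd
  dsimp only at this
  omega

/-- The change of the `q`-th Betti number at the value `c`. -/
lemma finrank_homology_sublevel (hK : K.faces.Finite) (hf : IsDiscreteMorse K f)
    (hexc : IsExcellent K f) (q : ℕ) (c : ℝ) :
    Module.finrank F (Homology F (sublevel K f c) q) +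
        ((pairsAt F K f ((q : ℤ) - 1) c).ncard + (pairsAt F K f q c).ncard) =
      Module.finrank F (Homology F (sublevelLT K f c) q) + (criticalAt K f q c).ncard := by
  have hm := hf.isMatched c
  -- By rank-nullity the kernel in degree `q` cancels the pairs of birth dimension `q`; what remains
  -- compares `H_q(K(c))` with the image of `H_q(K(<c))`.
  rw [← finrank_homology_eq (finite_sublevelLT hK c) sublevelLT_le, ncard_pairsAt hK hf hexc]
  by_cases hcrit : ∃ σ, σ ∈ criticalAt K f q c
  · obtain ⟨σ, ⟨hσ, hd⟩, hc⟩ := hcrit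
    have hone : criticalAt K f q c = {σ} := by
      refine Set.eq_singleton_iff_unique_mem.mpr ⟨⟨⟨hσ, hd⟩, hc⟩, ?_⟩
      rintro α ⟨⟨hα, -⟩, hαc⟩
      exact hexc hα hσ (hαc.trans hc.symm)
    rw [hone, Set.ncard_singleton]
    have hσu := hf.mem_unmatched.mpr ⟨hσ, hc⟩
    have hu := eq_of_mem_unmatched hf hexc hσu
    rw [dim_eq_iff] at hd
    cases q with
    | zero =>
      have := hm.finrank_zero (F := F) (finite_sublevel hK c) hσu hu hd
      rw [show ((0 : ℕ) : ℤ) - 1 = -1 by simp, pairsAt_neg_one, Set.ncard_empty]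
      omega
    | succ q =>
      have := hm.finrank_succ (F := F) (finite_sublevel hK c) hσu hu hd
      rw [show ((q + 1 : ℕ) : ℤ) - 1 = q by simp, ncard_pairsAt hK hf hexc]
      omega
  · rw [Set.eq_empty_iff_forall_notMem.mpr (not_exists.mp hcrit), Set.ncard_empty]
    have hno : ∀ α ∈ unmatched (sublevelLT K f c) (sublevel K f c), α.card ≠ q + 1 := by
      intro α hα hαc
      obtain ⟨h1, h2⟩ := hf.mem_unmatched.mp hα
      exact hcrit ⟨α, ⟨h1, dim_eq_iff.mpr hαc⟩, h2⟩
    have h0 : (pairsAt F K f ((q : ℤ) - 1) c).ncard = 0 := by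
      cases q with
      | zero => rw [show ((0 : ℕ) : ℤ) - 1 = -1 by simp, pairsAt_neg_one, Set.ncard_empty]
      | succ q =>
        rw [show ((q + 1 : ℕ) : ℤ) - 1 = q by simp, ncard_pairsAt hK hf hexc, hm.ker_eq_bot hno,
          finrank_bot]
    rw [hm.range_eq_top hno, finrank_top, h0]
    omega

/-- The one-step balances telescope, by induction on the number of values below `c`. Using `K(<c)`
lets the sum start from the empty complex, and pairs are added on the left to avoid subtraction in
`ℕ`. -/
lemma finrank_homology_sublevelLT (hK : K.faces.Finite) (hf : IsDiscreteMorse K f)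
    (hexc : IsExcellent K f) (q : ℕ) (V : Finset ℝ) (hV : ∀ c, c ∈ V ↔ ∃ σ ∈ K, f σ = c) (c : ℝ) :
    Module.finrank F (Homology F (sublevelLT K f c) q) +
        ∑ v ∈ V with v < c, ((pairsAt F K f ((q : ℤ) - 1) v).ncard + (pairsAt F K f q v).ncard) =
      ∑ v ∈ V with v < c, (criticalAt K f q v).ncard := by
  induction hn : (V.filter (· < c)).card using Nat.strong_induction_on generalizing c with
  | _ n ih =>
  subst hn
  obtain he | ⟨σ, hσ, hσc, hmax, he⟩ := exists_preceding_value hK f c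
  · have hV0 : V.filter (· < c) = ∅ := Finset.filter_eq_empty_iff.mpr fun v hv => by
      obtain ⟨σ, hσ, rfl⟩ := (hV v).mp hv
      exact he σ hσ
    have := subsingleton_homology (F := F) (q := q) he
    rw [hV0, Finset.sum_empty, Finset.sum_empty, add_zero]
    exact Module.finrank_zero_of_subsingleton
  · have hins : V.filter (· < c) = insert (f σ) (V.filter (· < f σ)) := by
      ext v
      simp only [Finset.mem_filter, Finset.mem_insert]
      constructor
      · rintro ⟨hv, hvc⟩
        obtain ⟨ρ, hρ, rfl⟩ := (hV v).mp hv
        exact (hmax ρ hρ hvc).eq_or_lt.imp id fun h => ⟨hv, h⟩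
      · rintro (rfl | ⟨hv, h⟩)
        · exact ⟨(hV _).mpr ⟨σ, hσ, rfl⟩, hσc⟩
        · exact ⟨hv, h.trans hσc⟩
    have hnot : f σ ∉ V.filter (· < f σ) := by simp
    have := ih _ (by rw [hins, Finset.card_insert_of_notMem hnot]; omega) (f σ) rfl
    have := finrank_homology_sublevel (F := F) hK hf hexc q (f σ)
    rw [he, hins, Finset.sum_insert hnot, Finset.sum_insert hnot]
    omega

end Pairs

/-! ### Summation over all values. -/

lemma sum_ncard_fiber {α β : Type*} {S : Set α} (hS : S.Finite) (g : α → β) (V : Finset β)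
    (h : ∀ s ∈ S, g s ∈ V) : ∑ v ∈ V, {s | s ∈ S ∧ g s = v}.ncard = S.ncard := by
  classical
  rw [Set.ncard_eq_toFinset_card S hS,
    Finset.card_eq_sum_card_fiberwise (f := g) (t := V) fun s hs => h s (hS.mem_toFinset.mp hs)]
  refine Finset.sum_congr rfl fun v _ => ?_
  rw [← Set.ncard_coe_finset]
  congr 1
  ext s
  simp

/-- The Morse equality: critical simplices are counted by Betti numbers and persistence pairs. -/
theorem ncard_criticalSimplices {F : Type*} [Field F] {ι : Type*} [LinearOrder ι]
    (K : PreAbstractSimplicialComplex ι) (hK : K.faces.Finite)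
    (f : Finset ι → ℝ) (hf : IsDiscreteMorse K f)
    (hexc : IsExcellent K f) (q : ℕ) :
    (criticalSimplices K f (q : ℤ)).ncard =
      betti F K q + (finitePairs F K f ((q : ℤ) - 1)).ncard +
        (finitePairs F K f (q : ℤ)).ncard := by
  classical
  let V : Finset ℝ := hK.toFinset.image f
  have hV : ∀ c, c ∈ V ↔ ∃ σ ∈ K, f σ = c := fun c => by
    simp only [V, Finset.mem_image, Set.Finite.mem_toFinset]; rfl
  -- Any `c` above all values gives `K(<c) = K`.
  obtain ⟨c, hc⟩ : ∃ c, ∀ v ∈ V, v < c :=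
    ((Filter.eventually_all_finset V).mpr fun v _ => Filter.eventually_gt_atTop v).exists
  have hKc : sublevelLT K f c = K := le_antisymm (sublevelLT_le.trans sublevel_le)
    fun σ hσ => ⟨nonempty_of_mem hσ, σ, hσ, hc _ ((hV _).mpr ⟨σ, hσ, rfl⟩), subset_rfl⟩
  have hcrit : (criticalSimplices K f (q : ℤ)).Finite := hK.subset fun _ h => h.1.1
  have hpairs : ∀ p : ℤ, (finitePairs F K f p).Finite := fun p =>
    (hK.prod hK).subset fun _ h => ⟨h.1.1.1, h.1.2.1.1⟩
  have hsum : ∀ p : ℤ, ∑ v ∈ V, (pairsAt F K f p v).ncard = (finitePairs F K f p).ncard :=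
    fun p => sum_ncard_fiber (hpairs p) (fun P => f P.2) V
      fun P h => (hV _).mpr ⟨_, h.1.2.1.1, rfl⟩
  have hcsum : ∑ v ∈ V, (criticalAt K f q v).ncard = (criticalSimplices K f (q : ℤ)).ncard :=
    sum_ncard_fiber hcrit f V fun σ h => (hV _).mpr ⟨σ, h.1.1, rfl⟩
  have key := finrank_homology_sublevelLT (F := F) hK hf hexc q V hV c
  rw [Finset.filter_true_of_mem hc, hKc, Finset.sum_add_distrib, hsum, hsum, hcsum] at key
  rw [← key, betti, add_assoc]

end DiscreteMorse

theorem corollary3p7 {F : Type*} [Field F] [Finite F] {ι : Type*} [LinearOrder ι]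
    (K : PreAbstractSimplicialComplex ι) (hK : K.faces.Finite)
    (f : Finset ι → ℝ) (hf : DiscreteMorse.IsDiscreteMorse K f)
    (hexc : DiscreteMorse.IsExcellent K f) (q : ℕ) :
    (DiscreteMorse.criticalSimplices K f (q : ℤ)).ncard =
      DiscreteMorse.betti F K q + (DiscreteMorse.finitePairs F K f ((q : ℤ) - 1)).ncard +
        (DiscreteMorse.finitePairs F K f (q : ℤ)).ncard := by
  exact DiscreteMorse.ncard_criticalSimplices K hK f hf hexc q
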